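/- Let $M$ be a smooth $n$-dimensional manifold with a Riemannian metric $g$, and let $\nabla$ be a torsion-free (smooth) affine connection on $M$ such that $(M,g,\nabla)$ is a statistical manifold, i.e. the cubic form $Q(X,Y,Z)=(\nabla_X g)(Y,Z)$ is symmetric in all three arguments. Let $\nabla^*$ be the dual connection of $\nabla$, i.e. the affine connection with $X\,g(Y,Z)=g(\nabla_X Y,Z)+g(Y,\nabla^*_X Z)$ for all smooth vector fields $X,Y,Z$. Let $Ric$ and $Ric^*$ be the Ricci tensors of $\nabla$ and $\nabla^*$, where $Ric(Y,Z)=\operatorname{tr}\{X\mapsto R(X,Y)Z\}$ and $R(X,Y)Z=\nabla_X\nabla_Y Z-\nabla_Y\nabla_X Z-\nabla_{[X,Y]}Z$, and similarly for $Ric^*$. If $(M,g,\nabla,\nabla^*)$ is conjugate Ricci-symmetric, i.e. $Ric(Y,Z)=Ric^*(Y,Z)$ for all vector fields $Y,Z$, then for every $\alpha\in\mathbb{R}$ the $\alpha$-connection $$\nabla^{(\alpha)}=\frac{1+\alpha}{2}\nabla+\frac{1-\alpha}{2}\nabla^*$$ is (locally) equiaffine: it is a torsion-free affine connection, and every point of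 $M$ has an open neighbourhood $U$ with a volume form $\omega$ on $U$ (a nowhere vanishing smooth $n$-form) that is parallel, $\nabla^{(\alpha)}\omega=0$ on $U$. -/

import Mathlib

open Bundle VectorField
open scoped Manifold ContDiff Topology

noncomputable section

namespace StatMfd

variable {n : ℕ} {M : Type*} [TopologicalSpace M] [ChartedSpace (EuclideanSpace ℝ (Fin n)) M]

/-- An affine connection on `M`, i.e. a covariant derivative on the tangent bundle. In Mathlib's
convention `D Y x (X x)` is `(∇_X Y)(x)`; values on non-differentiable fields are irrelevant. -/
abbrev AffineConnection (n : ℕ) (M : Type*) [TopologicalSpace M]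
    [ChartedSpace (EuclideanSpace ℝ (Fin n)) M] [IsManifold (𝓡 n) ∞ M] :=
  CovariantDerivative (𝓡 n) (EuclideanSpace ℝ (Fin n)) (TangentSpace (𝓡 n) : M → Type _)

/-- The affine connection `D` is of class `C^∞`. -/
abbrev AffineConnection.IsSmooth [IsManifold (𝓡 n) ∞ M] (D : AffineConnection n M) : Prop :=
  CovariantDerivative.ContMDiffCovariantDerivative D ∞

/-- The smooth vector fields on `M`. -/
abbrev SmoothVectorField (n : ℕ) (M : Type*) [TopologicalSpace M]
    [ChartedSpace (EuclideanSpace ℝ (Fin n)) M] [IsManifold (𝓡 n) ∞ M] :=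
  Cₛ^∞⟮𝓡 n; EuclideanSpace ℝ (Fin n), (TangentSpace (𝓡 n) : M → Type _)⟯

/-- A smooth Riemannian metric on `M`. -/
abbrev Metric (n : ℕ) (M : Type*) [TopologicalSpace M]
    [ChartedSpace (EuclideanSpace ℝ (Fin n)) M] [IsManifold (𝓡 n) ∞ M] :=
  ContMDiffRiemannianMetric (𝓡 n) ∞ (EuclideanSpace ℝ (Fin n))
    (fun x : M ↦ TangentSpace (𝓡 n) x)

variable [IsManifold (𝓡 n) ∞ M]

/-! ### Curvature and Ricci curvature -/

/-- `R(X, Y)Z = ∇_X ∇_Y Z - ∇_Y ∇_X Z - ∇_{[X, Y]} Z`. -/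
def curvature (D : AffineConnection n M) (X Y Z : Π x : M, TangentSpace (𝓡 n) x) (x : M) :
    TangentSpace (𝓡 n) x :=
  D (fun y ↦ D Z y (Y y)) x (X x) - D (fun y ↦ D Z y (X y)) x (Y x)
    - D Z x (mlieBracket (𝓡 n) X Y x)

theorem mdifferentiableAt_covDeriv (D : AffineConnection n M) (hD : D.IsSmooth)
    (Z : SmoothVectorField n M) {X : Π x : M, TangentSpace (𝓡 n) x} {x : M}
    (hX : MDifferentiableAt (𝓡 n) (𝓡 n).tangent (T% X) x) :
    MDifferentiableAt (𝓡 n) (𝓡 n).tangent (T% (fun y ↦ D Z y (X y))) x := by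
  have h := hD.contMDiff.contMDiff (σ := Z) (Z.contMDiff.contMDiffOn)
  have h' := (h.contMDiffAt Filter.univ_mem : ContMDiffAt _ _ _ _ x).mdifferentiableAt
    (by simp)
  exact h'.clm_bundle_apply hX

theorem tensorialAt_curvature (D : AffineConnection n M) (hD : D.IsSmooth)
    (Y Z : SmoothVectorField n M) (x : M) :
    TensorialAt (𝓡 n) (EuclideanSpace ℝ (Fin n)) (fun X ↦ curvature D X Y Z x) x where
  smul {f X} hf hX := by
    have e : (fun y ↦ D Z y ((f • X) y)) = f • (fun y ↦ D Z y (X y)) := by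
      ext1 y; simp
    unfold curvature
    rw [e, D.isCovariantDerivativeOn.leibniz (mdifferentiableAt_covDeriv D hD Z hX) hf,
      mlieBracket_smul_left hf hX]
    simp
    module
  add {X X'} hX hX' := by
    have e : (fun y ↦ D Z y ((X + X') y)) = (fun y ↦ D Z y (X y)) + (fun y ↦ D Z y (X' y)) := by
      ext1 y; simp
    unfold curvature
    rw [e, D.isCovariantDerivativeOn.add (mdifferentiableAt_covDeriv D hD Z hX)
      (mdifferentiableAt_covDeriv D hD Z hX'), mlieBracket_add_left hX hX']
    simp
    module

/-- The endomorphism `X ↦ R(X, Y)Z` of the tangent space at `x`. -/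
def curvatureEnd (D : AffineConnection n M) (hD : D.IsSmooth) (Y Z : SmoothVectorField n M)
    (x : M) : TangentSpace (𝓡 n) x →L[ℝ] TangentSpace (𝓡 n) x :=
  TensorialAt.mkHom (fun X ↦ curvature D X Y Z x) x (tensorialAt_curvature D hD Y Z x)

/-- The Ricci tensor `Ric(Y, Z) = tr (X ↦ R(X, Y)Z)`, evaluated at the point `x`. -/
def ricci (D : AffineConnection n M) (hD : D.IsSmooth) (Y Z : SmoothVectorField n M) (x : M) : ℝ :=
  LinearMap.trace ℝ (TangentSpace (𝓡 n) x) (curvatureEnd D hD Y Z x : _ →ₗ[ℝ] _)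

/-! ### Statistical manifolds -/

/-- The cubic form `Q(X, Y, Z) = (∇_X g)(Y, Z) = X(g(Y, Z)) - g(∇_X Y, Z) - g(Y, ∇_X Z)`. -/
def cubicForm (g : Metric n M) (D : AffineConnection n M) (X Y Z : SmoothVectorField n M)
    (x : M) : ℝ :=
  mvfderiv (𝓡 n) (fun y ↦ g.inner y (Y y) (Z y)) x (X x)
    - g.inner x (D Y x (X x)) (Z x) - g.inner x (Y x) (D Z x (X x))

/-- `(M, g, ∇)` is a statistical manifold: `∇` is torsion-free and the cubic form `∇g` is
symmetric in its three arguments. -/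
structure IsStatistical (g : Metric n M) (D : AffineConnection n M) : Prop where
  torsion_free : D.torsion = 0
  cubic_symm_left : ∀ X Y Z : SmoothVectorField n M, cubicForm g D X Y Z = cubicForm g D Y X Z
  cubic_symm_right : ∀ X Y Z : SmoothVectorField n M, cubicForm g D X Y Z = cubicForm g D X Z Y

/-- `D'` is the dual connection of `D` with respect to `g`:
`X(g(Y, Z)) = g(∇_X Y, Z) + g(Y, ∇*_X Z)`. -/
def IsDual (g : Metric n M) (D D' : AffineConnection n M) : Prop :=
  ∀ (X Y Z : SmoothVectorField n M) (x : M),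
    mvfderiv (𝓡 n) (fun y ↦ g.inner y (Y y) (Z y)) x (X x)
      = g.inner x (D Y x (X x)) (Z x) + g.inner x (Y x) (D' Z x (X x))

/-- Conjugate Ricci-symmetry: the Ricci tensors of the two connections coincide. -/
def ConjugateRicciSymmetric (D D' : AffineConnection n M) (hD : D.IsSmooth) (hD' : D'.IsSmooth) :
    Prop :=
  ∀ (Y Z : SmoothVectorField n M) (x : M), ricci D hD Y Z x = ricci D' hD' Y Z x

/-- The `α`-connection `((1 + α)/2) ∇ + ((1 - α)/2) ∇*`. -/
def alphaConnection (D D' : AffineConnection n M) (α : ℝ) : AffineConnection n M where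
  toFun Y x := ((1 + α) / 2) • D Y x + ((1 - α) / 2) • D' Y x
  isCovariantDerivativeOnUniv :=
    { add := fun hσ hσ' _ ↦ by
        rw [D.isCovariantDerivativeOn.add hσ hσ', D'.isCovariantDerivativeOn.add hσ hσ']
        module
      leibniz := fun hσ hf _ ↦ by
        rw [D.isCovariantDerivativeOn.leibniz hσ hf, D'.isCovariantDerivativeOn.leibniz hσ hf]
        module }

/-! ### Equiaffine connections -/

/-- A field of alternating `n`-forms on the tangent spaces of the `n`-dimensional manifold `M`. -/
abbrev TopForm (n : ℕ) (M : Type*) [TopologicalSpace M]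
    [ChartedSpace (EuclideanSpace ℝ (Fin n)) M] :=
  Π x : M, TangentSpace (𝓡 n) x [⋀^Fin n]→L[ℝ] ℝ

/-- The field of vectors `X` is smooth on `U`. -/
abbrev SmoothOn (U : Set M) (X : Π x : M, TangentSpace (𝓡 n) x) : Prop :=
  ContMDiffOn (𝓡 n) (𝓡 n).tangent ∞ (T% X) U

/-- `θ` is a volume form on the open set `U`: it is smooth on `U` (its values on smooth vector
fields on `U` are smooth functions) and nowhere zero on `U`. Values outside `U` are irrelevant. -/
structure IsVolumeFormOn (θ : TopForm n M) (U : Set M) : Prop where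
  smooth : ∀ Y : Fin n → Π x : M, TangentSpace (𝓡 n) x, (∀ i, SmoothOn U (Y i)) →
    ContMDiffOn (𝓡 n) 𝓘(ℝ, ℝ) ∞ (fun x ↦ θ x (fun i ↦ Y i x)) U
  ne_zero : ∀ x ∈ U, θ x ≠ 0

/-- `(∇_v θ)(Y₁, …, Yₙ) = v(θ(Y₁, …, Yₙ)) - ∑ᵢ θ(Y₁, …, ∇_v Yᵢ, …, Yₙ)` at the point `x`. -/
def covDerivForm (D : AffineConnection n M) (θ : TopForm n M) (x : M) (v : TangentSpace (𝓡 n) x)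
    (Y : Fin n → Π x : M, TangentSpace (𝓡 n) x) : ℝ :=
  mvfderiv (𝓡 n) (fun y ↦ θ y (fun i ↦ Y i y)) x v
    - ∑ i, θ x (Function.update (fun j ↦ Y j x) i (D (Y i) x v))

/-- `∇θ = 0` on the open set `U`. -/
def IsParallelOn (D : AffineConnection n M) (θ : TopForm n M) (U : Set M) : Prop :=
  ∀ Y : Fin n → Π x : M, TangentSpace (𝓡 n) x, (∀ i, SmoothOn U (Y i)) →
    ∀ x ∈ U, ∀ v : TangentSpace (𝓡 n) x, covDerivForm D θ x v Y = 0

/-- A (locally) equiaffine connection: a smooth torsion-free affine connection such that every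
point of `M` has an open neighbourhood carrying a parallel volume form. -/
structure IsEquiaffine (D : AffineConnection n M) : Prop where
  smooth : D.IsSmooth
  torsion_free : D.torsion = 0
  exists_parallel : ∀ p : M, ∃ U : Set M, IsOpen U ∧ p ∈ U ∧
    ∃ θ : TopForm n M, IsVolumeFormOn θ U ∧ IsParallelOn D θ U

end StatMfd

end

/-!
The first Bianchi identity of a torsion-free connection gives
`Ric(Y, Z) - Ric(Z, Y) = -tr R(Y, Z)`, and differentiating the duality relation gives
`tr R + tr R* = 0`. Hence `Ric = Ric*` forces `tr R = tr R* = 0`. In a local frame `tr R = dτ`,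
where `τ` is the trace of the connection form, so `τ`, `τ*`, and therefore
`τ^(α) = (1 + α)/2 τ + (1 - α)/2 τ*`, are closed. By the Poincaré lemma `τ^(α) = df` near each
point, and `e^f` times the wedge product of the dual coframe is parallel for `∇^(α)`.
-/

noncomputable section

namespace StatMfd

section LinearAlgebra

variable {ι R : Type*} [Fintype ι] [DecidableEq ι] [CommRing R]

theorem sum_det_updateRow_mul (A B : Matrix ι ι R) :
    ∑ i, (A.updateRow i ((A * B).row i)).det = B.trace * A.det := by
  have hrow (i : ι) : (A.updateRow i ((A * B).row i)).det = (A * B * A.adjugate) i i := by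
    rw [← Matrix.cramer_transpose_apply, Matrix.cramer_eq_adjugate_mulVec,
      ← Matrix.adjugate_transpose, Matrix.mulVec_transpose]
    rfl
  calc ∑ i, (A.updateRow i ((A * B).row i)).det
      = (A * B * A.adjugate).trace := Finset.sum_congr rfl fun i _ ↦ hrow i
    _ = (B * (A.adjugate * A)).trace := by rw [Matrix.mul_assoc, Matrix.trace_mul_comm,
        Matrix.mul_assoc]
    _ = B.trace * A.det := by simp [Matrix.adjugate_mul, mul_comm]

theorem trace_add_trace_eq_zero {A B G : Matrix ι ι R} (hG : IsUnit G.det)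
    (h : A * G + G * B.transpose = 0) : A.trace + B.trace = 0 := by
  have hconj : A = -(G * B.transpose * G⁻¹) := by
    rw [← Matrix.mul_nonsing_inv_cancel_right G A hG, eq_neg_of_add_eq_zero_left h,
      Matrix.neg_mul]
  rw [hconj, Matrix.trace_neg, Matrix.trace_mul_cycle, Matrix.nonsing_inv_mul G hG, one_mul,
    Matrix.trace_transpose, neg_add_cancel]

end LinearAlgebra

section Calculus

variable {𝕜 : Type*} [NontriviallyNormedField 𝕜]
  {E : Type*} [NormedAddCommGroup E] [NormedSpace 𝕜 E]
  {H : Type*} [TopologicalSpace H] {I : ModelWithCorners 𝕜 E H}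
  {M : Type*} [TopologicalSpace M] [ChartedSpace H M]
  {F : Type*} [NormedAddCommGroup F] [NormedSpace 𝕜 F]
  {F' : Type*} [NormedAddCommGroup F'] [NormedSpace 𝕜 F']

theorem mvfderiv_congr {f g : M → F} {x : M} (h : f =ᶠ[𝓝 x] g) (v : TangentSpace I x) :
    mvfderiv I f x v = mvfderiv I g x v :=
  DFunLike.congr_fun (h.mfderiv_eq (I := I) (I' := 𝓘(𝕜, F))) v

theorem mvfderiv_comp_of_hasFDerivAt {G : F → F'} {G' : F →L[𝕜] F'} {f : M → F} {x : M}
    (hG : HasFDerivAt G G' (f x)) (hf : MDiffAt f x) (v : TangentSpace I x) :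
    mvfderiv I (G ∘ f) x v = G' (mvfderiv I f x v) :=
  DFunLike.congr_fun (hG.hasMFDerivAt.comp x hf.hasMFDerivAt).mfderiv v

theorem mvfderiv_sum {ι : Type*} (s : Finset ι) {f : ι → M → F} {x : M}
    (hf : ∀ i ∈ s, MDiffAt (f i) x) :
    mvfderiv I (fun y ↦ ∑ i ∈ s, f i y) x = ∑ i ∈ s, mvfderiv I (f i) x := by
  classical
  suffices MDiffAt (fun y ↦ ∑ i ∈ s, f i y) x ∧
    mvfderiv I (fun y ↦ ∑ i ∈ s, f i y) x = ∑ i ∈ s, mvfderiv I (f i) x from this.2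
  induction s using Finset.induction_on with
  | empty => exact ⟨mdifferentiableAt_const, mvfderiv_const 0⟩
  | insert a s ha ih =>
    simp only [Finset.mem_insert, forall_eq_or_imp] at hf
    obtain ⟨hdiff, hderiv⟩ := ih hf.2
    simp only [Finset.sum_insert ha, ← hderiv]
    exact ⟨hf.1.add hdiff, mvfderiv_fun_add hf.1 hdiff⟩

theorem contMDiff_mvfderiv_apply [IsManifold I ∞ M] {f : M → F} (hf : CMDiff ∞ f)
    {X : Π x : M, TangentSpace I x} (hX : CMDiff ∞ (T% X)) :
    CMDiff ∞ (fun y ↦ mvfderiv I f y (X y)) :=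
  (contMDiff_snd_tangentBundle_modelSpace F 𝓘(𝕜, F)).comp
    ((hf.contMDiff_tangentMap (m := ∞) (by simp)).comp hX)

theorem mdifferentiableAt_pi {ι : Type*} [Fintype ι] {f : M → ι → F} {x : M}
    (hf : ∀ i, MDiffAt (fun y ↦ f y i) x) :
    MDifferentiableAt I 𝓘(𝕜, ι → F) f x :=
  (mdifferentiableAt_iff _ _).2 ⟨continuousAt_pi.2 fun i ↦ (hf i).continuousAt,
    differentiableWithinAt_pi.2 fun i ↦ ((mdifferentiableAt_iff _ _).1 (hf i)).2⟩

theorem mvfderiv_det {ι : Type*} [Fintype ι] [DecidableEq ι] {A : M → Matrix ι ι 𝕜} {x : M}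
    (hA : ∀ i j, MDiffAt (fun y ↦ A y i j) x) (v : TangentSpace I x) :
    mvfderiv I (fun y ↦ (A y).det) x v
      = ∑ i, ((A x).updateRow i fun j ↦ mvfderiv I (fun y ↦ A y i j) x v).det := by
  let det : ContinuousMultilinearMap 𝕜 (fun _ : ι ↦ ι → 𝕜) 𝕜 :=
    ⟨Matrix.detRowAlternating.toMultilinearMap, Continuous.matrix_det continuous_id⟩
  let rows (y : M) (i j : ι) : 𝕜 := A y i j
  have hrows : MDifferentiableAt I 𝓘(𝕜, ι → ι → 𝕜) rows x :=
    mdifferentiableAt_pi fun i ↦ mdifferentiableAt_pi fun j ↦ hA i j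
  have hentry (i j : ι) : mvfderiv I rows x v i j = mvfderiv I (fun y ↦ A y i j) x v :=
    (mvfderiv_comp_of_hasFDerivAt ((ContinuousLinearMap.proj (R := 𝕜) (φ := fun _ : ι ↦ 𝕜) j ∘L
      ContinuousLinearMap.proj (R := 𝕜) (φ := fun _ : ι ↦ ι → 𝕜) i).hasFDerivAt) hrows v).symm
  refine (mvfderiv_comp_of_hasFDerivAt (det.hasFDerivAt (rows x)) hrows v).trans ?_
  rw [ContinuousMultilinearMap.linearDeriv_apply]
  refine Finset.sum_congr rfl fun i _ ↦ ?_
  rw [← funext (hentry i)]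
  rfl

end Calculus

section LocalFrame

variable {𝕜 : Type*} [NontriviallyNormedField 𝕜]
  {E : Type*} [NormedAddCommGroup E] [NormedSpace 𝕜 E]
  {H : Type*} [TopologicalSpace H] {I : ModelWithCorners 𝕜 E H}
  {M : Type*} [TopologicalSpace M] [ChartedSpace H M]
  {F : Type*} [NormedAddCommGroup F] [NormedSpace 𝕜 F]
  {V : M → Type*} [TopologicalSpace (TotalSpace F V)] [∀ x, AddCommGroup (V x)]
  [∀ x, Module 𝕜 (V x)] [∀ x, TopologicalSpace (V x)] [FiberBundle F V]
  {ι : Type*} {k : ℕ∞ω} {s : ι → (x : M) → V x} {U : Set M} {x : M}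

theorem localFrame_coeff_self [DecidableEq ι] (hs : IsLocalFrameOn I F k s U) (hx : x ∈ U)
    (i j : ι) : hs.coeff i x (s j x) = (Pi.single j 1 : ι → 𝕜) i := by
  rw [hs.coeff_apply_of_mem hx, ← hs.toBasisAt_coe hx j, Module.Basis.repr_self,
    Finsupp.single_eq_pi_single]

variable [VectorBundle 𝕜 F V] [ContMDiffVectorBundle k F V I]

theorem contMDiffAt_localFrame_coeff [CompleteSpace 𝕜] [Finite ι]
    (hs : IsLocalFrameOn I F k s U) (hU : U ∈ 𝓝 x) {t : (x : M) → V x}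
    (ht : CMDiffAt k (T% t) x) (i : ι) :
    CMDiffAt k (fun y ↦ hs.coeff i y (t y)) x := by
  classical
  have := Fintype.ofFinite ι
  let e := trivializationAt F V x
  have hxe : x ∈ e.baseSet := FiberBundle.mem_baseSet_trivializationAt F V x
  let L (y : M) : (ι → 𝕜) →L[𝕜] F :=
    ∑ j, (ContinuousLinearMap.proj j).smulRight (e (TotalSpace.mk' F y (s j y))).2
  have hL : CMDiffAt k L x := contMDiffAt_finsetSum fun j _ ↦ by
    have := (e.contMDiffAt_section_iff hxe).1 ((hs.contMDiffOn j).contMDiffAt hU)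
    exact (ContinuousLinearMap.smulRightL 𝕜 (ι → 𝕜) F
      (ContinuousLinearMap.proj j)).contMDiff.contMDiffAt.comp x this
  have hLequiv {y : M} (hy : y ∈ U) (hye : y ∈ e.baseSet) :
      L y = ((hs.toBasisAt hy).equivFun.symm ≪≫ₗ
        e.linearEquivAt 𝕜 y hye).toContinuousLinearEquiv := by
    ext j
    simp [L, Module.Basis.equivFun_symm_apply]
  have hinv : CMDiffAt k (fun y ↦ (L y).inverse) x := by
    have : ContDiffAt 𝕜 k ContinuousLinearMap.inverse (L x) := by
      rw [hLequiv (mem_of_mem_nhds hU) hxe]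
      exact contDiffAt_map_inverse _
    exact this.contMDiffAt.comp x hL
  have hcoeff : CMDiffAt k (fun y ↦ (L y).inverse (e (TotalSpace.mk' F y (t y))).2 i) x :=
    contMDiffAt_pi_space.1 (hinv.clm_apply ((e.contMDiffAt_section_iff hxe).1 ht)) i
  refine hcoeff.congr_of_eventuallyEq ?_
  filter_upwards [hU, e.open_baseSet.mem_nhds hxe] with y hy hye
  rw [hLequiv hy hye, ContinuousLinearMap.inverse_equiv]
  simp [hy, e.symm_apply_apply_mk hye]

variable [∀ x, IsTopologicalAddGroup (V x)] [∀ x, ContinuousSMul 𝕜 (V x)]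

theorem covariantDerivative_sum_smul (D : CovariantDerivative I F V) (S : Finset ι)
    {f : ι → M → 𝕜} (hf : ∀ i, MDiffAt (f i) x) (hs : ∀ i, MDiffAt (T% (s i)) x) :
    D (fun y ↦ ∑ i ∈ S, f i y • s i y) x
      = ∑ i ∈ S, (f i x • D (s i) x + (mvfderiv I (f i) x).smulRight (s i x)) := by
  classical
  induction S using Finset.induction_on with
  | empty =>
    simp only [Finset.sum_empty]
    exact D.isCovariantDerivativeOn.zero
  | insert a S ha ih =>
    simp only [Finset.sum_insert ha]
    rw [← ih, ← D.isCovariantDerivativeOn.leibniz (hs a) (hf a)]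
    exact D.isCovariantDerivativeOn.add ((hf a).smul_section (hs a))
      (MDifferentiableAt.sum_section fun i _ ↦ (hf i).smul_section (hs i))

theorem localFrame_coeff_covariantDerivative [CompleteSpace 𝕜] [Fintype ι]
    (D : CovariantDerivative I F V) (hs : IsLocalFrameOn I F k s U) (hk : k ≠ 0) (hU : U ∈ 𝓝 x)
    {t : (x : M) → V x} (ht : CMDiffAt k (T% t) x) (v : TangentSpace I x) (l : ι) :
    hs.coeff l x (D t x v) = mvfderiv I (fun y ↦ hs.coeff l y (t y)) x v
      + ∑ m, hs.coeff m x (t x) * hs.coeff l x (D (s m) x v) := by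
  classical
  have hcoeff (i : ι) : MDiffAt (fun y ↦ hs.coeff i y (t y)) x :=
    (contMDiffAt_localFrame_coeff hs hU ht i).mdifferentiableAt hk
  have hframe (i : ι) : MDiffAt (T% (s i)) x :=
    ((hs.contMDiffOn i).contMDiffAt hU).mdifferentiableAt hk
  have hexpand : D t x = D (fun y ↦ ∑ i, hs.coeff i y (t y) • s i y) x := by
    refine D.isCovariantDerivativeOn.congr_of_eventuallyEq (s := Set.univ)
      (ht.mdifferentiableAt hk)
      (MDifferentiableAt.sum_section fun i _ ↦ (hcoeff i).smul_section (hframe i))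
      Filter.univ_mem ?_
    filter_upwards [hU] with y hy using hs.coeff_sum_eq t hy
  rw [hexpand, covariantDerivative_sum_smul D _ hcoeff hframe, _root_.sum_apply, map_sum]
  simp [Finset.sum_add_distrib, localFrame_coeff_self hs (mem_of_mem_nhds hU),
    Pi.single_apply, add_comm]

end LocalFrame

local instance isManifold_minSmoothness {𝕜 : Type*} [NontriviallyNormedField 𝕜]
    [IsRCLikeNormedField 𝕜] {E : Type*} [NormedAddCommGroup E] [NormedSpace 𝕜 E]
    {H : Type*} [TopologicalSpace H] {I : ModelWithCorners 𝕜 E H}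
    {M : Type*} [TopologicalSpace M] [ChartedSpace H M] [IsManifold I ∞ M]
    {k : ℕ∞ω} [ENat.LEInfty k] : IsManifold I (minSmoothness 𝕜 k) M := by
  rw [minSmoothness_of_isRCLikeNormedField]
  infer_instance

section LieBracket

variable {𝕜 : Type*} [NontriviallyNormedField 𝕜] [IsRCLikeNormedField 𝕜]
  {E : Type*} [NormedAddCommGroup E] [NormedSpace 𝕜 E] [CompleteSpace E]
  {H : Type*} [TopologicalSpace H] {I : ModelWithCorners 𝕜 E H}
  {M : Type*} [TopologicalSpace M] [ChartedSpace H M] [IsManifold I ∞ M]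

theorem contMDiffAt_mlieBracket {X Y : Π x : M, TangentSpace I x} {x : M}
    (hX : CMDiffAt ∞ (T% X) x) (hY : CMDiffAt ∞ (T% Y) x) :
    CMDiffAt ∞ (T% (mlieBracket I X Y)) x :=
  haveI : IsManifold I (((⊤ : ℕ∞) : ℕ∞ω) + 1) M := ‹IsManifold I ∞ M›
  ContMDiffAt.mlieBracket_vectorField (m := ⊤) (n := ⊤) hX hY
    (minSmoothness_of_isRCLikeNormedField.trans rfl).le

theorem mlieBracket_mlieBracket {X Y Z : Π x : M, TangentSpace I x} {x : M}
    (hX : CMDiffAt ∞ (T% X) x) (hY : CMDiffAt ∞ (T% Y) x) (hZ : CMDiffAt ∞ (T% Z) x) :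
    mlieBracket I X (mlieBracket I Y Z) x =
      mlieBracket I (mlieBracket I X Y) Z x + mlieBracket I Y (mlieBracket I X Z) x :=
  have le_smooth : minSmoothness 𝕜 2 ≤ ∞ :=
    minSmoothness_of_isRCLikeNormedField.trans_le ENat.LEInfty.out
  leibniz_identity_mlieBracket_apply (hX.of_le le_smooth) (hY.of_le le_smooth)
    (hZ.of_le le_smooth)

theorem mlieBracket_mlieBracket_smul {X Y Z : Π x : M, TangentSpace I x} {f : M → 𝕜} {x : M}
    (hY : CMDiff ∞ (T% Y)) (hZ : CMDiffAt ∞ (T% Z) x) (hf : CMDiff ∞ f) :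
    mlieBracket I X (mlieBracket I Y (f • Z)) x =
      mvfderiv I (fun y ↦ mvfderiv I f y (Y y)) x (X x) • Z x
        + mvfderiv I f x (Y x) • mlieBracket I X Z x
        + mvfderiv I f x (X x) • mlieBracket I Y Z x
        + f x • mlieBracket I X (mlieBracket I Y Z) x := by
  have hfx (y : M) : MDiffAt f y := hf.mdifferentiable (by simp) y
  have hYf := (contMDiff_mvfderiv_apply hf hY).mdifferentiable (by simp) x
  have hZx : MDiffAt (T% Z) x := hZ.mdifferentiableAt (by simp)
  have hYZ : MDiffAt (T% (mlieBracket I Y Z)) x :=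
    (contMDiffAt_mlieBracket hY.contMDiffAt hZ).mdifferentiableAt (by simp)
  have hexpand : mlieBracket I Y (f • Z) =ᶠ[𝓝 x]
      (fun y ↦ mvfderiv I f y (Y y)) • Z + f • mlieBracket I Y Z := by
    filter_upwards [(contMDiffAt_iff_contMDiffAt_nhds (by simp)).1
      (hZ.of_le (ENat.LEInfty.out (m := 1)))] with y hy
    exact mlieBracket_smul_right (hfx y) (hy.mdifferentiableAt one_ne_zero)
  rw [Filter.EventuallyEq.mlieBracket_vectorField_eq (Filter.EventuallyEq.refl _ X) hexpand,
    mlieBracket_add_right (hYf.smul_section hZx) ((hfx x).smul_section hYZ),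
    mlieBracket_smul_right hYf hZx, mlieBracket_smul_right (hfx x) hYZ]
  abel

/-- The identity is read off the `Z`-component of the Jacobi identity for `X`, `Y`, `f • Z`. -/
theorem mvfderiv_mlieBracket {X Y : Π x : M, TangentSpace I x} {f : M → 𝕜}
    (hX : CMDiff ∞ (T% X)) (hY : CMDiff ∞ (T% Y)) (hf : CMDiff ∞ f) (x : M) :
    mvfderiv I f x (mlieBracket I X Y x) =
      mvfderiv I (fun y ↦ mvfderiv I f y (Y y)) x (X x)
        - mvfderiv I (fun y ↦ mvfderiv I f y (X y)) x (Y x) := by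
  rcases subsingleton_or_nontrivial (TangentSpace I x) with _ | _
  · simp [Subsingleton.elim (_ : TangentSpace I x) 0]
  obtain ⟨v, hv⟩ := exists_ne (0 : TangentSpace I x)
  let Z := FiberBundle.extend E v
  have hZ : CMDiffAt ∞ (T% Z) x := FiberBundle.contMDiffAt_extend I E v
  have hZx : MDiffAt (T% Z) x := hZ.mdifferentiableAt (by simp)
  have hfx : MDiffAt f x := hf.mdifferentiable (by simp) x
  have hjacobi := mlieBracket_mlieBracket hX.contMDiffAt hY.contMDiffAt
    (hf.contMDiffAt.smul_section hZ)
  rw [mlieBracket_mlieBracket_smul hY hZ hf, mlieBracket_mlieBracket_smul hX hZ hf,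
    mlieBracket_smul_right hfx hZx, mlieBracket_mlieBracket hX.contMDiffAt hY.contMDiffAt hZ]
    at hjacobi
  have hcancel : (mvfderiv I f x (mlieBracket I X Y x)
      - (mvfderiv I (fun y ↦ mvfderiv I f y (Y y)) x (X x)
        - mvfderiv I (fun y ↦ mvfderiv I f y (X y)) x (Y x))) • Z x = 0 := by
    rw [← sub_eq_zero] at hjacobi
    rw [← neg_eq_zero, ← hjacobi]
    module
  rw [show Z x = v from FiberBundle.extend_apply_self E v] at hcancel
  exact sub_eq_zero.1 ((smul_eq_zero.1 hcancel).resolve_right hv)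

end LieBracket

section Extension

variable {E : Type*} [NormedAddCommGroup E] [NormedSpace ℝ E] [FiniteDimensional ℝ E]
  {H : Type*} [TopologicalSpace H] {I : ModelWithCorners ℝ E H}
  {M : Type*} [TopologicalSpace M] [ChartedSpace H M] [T2Space M] [IsManifold I ∞ M]
  {F : Type*} [NormedAddCommGroup F] [NormedSpace ℝ F]
  {V : M → Type*} [TopologicalSpace (TotalSpace F V)] [∀ x, AddCommGroup (V x)]
  [∀ x, Module ℝ (V x)] [∀ x, TopologicalSpace (V x)] [FiberBundle F V] [VectorBundle ℝ F V]

theorem exists_contMDiff_eventuallyEq_section {s : Π x, V x} {x : M}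
    (hs : ∀ᶠ y in 𝓝 x, CMDiffAt ∞ (T% s) y) :
    ∃ t : Π x, V x, CMDiff ∞ (T% t) ∧ ∀ᶠ y in 𝓝 x, t y = s y := by
  obtain ⟨U, hUs, hU, hxU⟩ := eventually_nhds_iff.1 hs
  obtain ⟨ρ, -, hρ⟩ := (SmoothBumpFunction.nhds_basis_tsupport (I := I) x).mem_iff.1
    (hU.mem_nhds hxU)
  refine ⟨(ρ : M → ℝ) • s, ContMDiffOn.smul_section_of_tsupport ρ.contMDiff.contMDiffOn hU hρ
    fun y hy ↦ (hUs y hy).contMDiffWithinAt, ?_⟩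
  filter_upwards [ρ.eventuallyEq_one] with y hy
  simp [hy]

end Extension

section ChartField

variable {E : Type*} [NormedAddCommGroup E] [NormedSpace ℝ E]
  {H : Type*} [TopologicalSpace H] {I : ModelWithCorners ℝ E H}
  {M : Type*} [TopologicalSpace M] [ChartedSpace H M]

variable (I) in
/-- The vector field with constant value `u` in the chart at `p`. -/
def chartField (p : M) (u : E) : Π x : M, TangentSpace I x :=
  mpullback I 𝓘(ℝ, E) (extChartAt I p) (fun _ ↦ u)

variable [IsManifold I ∞ M] {F : Type*} [NormedAddCommGroup F] [NormedSpace ℝ F]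
  {f : M → F} {p x : M}

theorem mvfderiv_extChartAt_chartField (hx : x ∈ (extChartAt I p).source) (u : E) :
    mvfderiv I (extChartAt I p) x (chartField I p u x) = u :=
  (isInvertible_mfderiv_extChartAt hx).self_apply_inverse u

theorem chartField_mvfderiv_extChartAt (hx : x ∈ (extChartAt I p).source) (v : TangentSpace I x) :
    chartField I p (mvfderiv I (extChartAt I p) x v) x = v :=
  (isInvertible_mfderiv_extChartAt hx).inverse_apply_self v

section Boundaryless

variable [I.Boundaryless]

theorem contDiffAt_comp_extChartAt_symm (hx : x ∈ (extChartAt I p).source) {k : ℕ∞}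
    (hf : CMDiffAt k f x) : ContDiffAt ℝ k (f ∘ (extChartAt I p).symm) (extChartAt I p x) := by
  have hsymm := (contMDiffOn_extChartAt_symm (I := I) (n := k) p).contMDiffAt
    (extChartAt_target_mem_nhds' ((extChartAt I p).map_source hx))
  refine ContMDiffAt.contDiffAt (ContMDiffAt.comp _ ?_ hsymm)
  rwa [(extChartAt I p).left_inv hx]

theorem mvfderiv_chartField (hx : x ∈ (extChartAt I p).source) (hf : CMDiffAt 1 f x) (u : E) :
    mvfderiv I f x (chartField I p u x)
      = fderiv ℝ (f ∘ (extChartAt I p).symm) (extChartAt I p x) u := by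
  have hchart : MDiffAt (extChartAt I p) x := mdifferentiableAt_extChartAt (by simpa using hx)
  have hf_eq : f =ᶠ[𝓝 x] (f ∘ (extChartAt I p).symm) ∘ extChartAt I p := by
    filter_upwards [(isOpen_extChartAt_source (I := I) p).mem_nhds hx] with y hy
    exact congrArg f ((extChartAt I p).left_inv hy).symm
  have hderiv := ((contDiffAt_comp_extChartAt_symm hx hf).differentiableAt (by simp)).hasFDerivAt
  rw [mvfderiv_congr hf_eq, mvfderiv_comp_of_hasFDerivAt hderiv hchart,
    mvfderiv_extChartAt_chartField hx]

end Boundaryless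

variable [CompleteSpace E]

theorem contMDiffAt_chartField (hx : x ∈ (extChartAt I p).source) (u : E) :
    CMDiffAt ∞ (T% (chartField I p u)) x :=
  ContMDiffAt.mpullback_vectorField_preimage (n := ∞) (V := fun _ ↦ u)
    (contMDiffAt_vectorSpace_iff_contDiffAt.2 contDiffAt_const)
    (contMDiffAt_extChartAt' (by simpa using hx)) (isInvertible_mfderiv_extChartAt hx) (by simp)

theorem mlieBracket_chartField (hx : x ∈ (extChartAt I p).source) (u v : E) :
    mlieBracket I (chartField I p u) (chartField I p v) x = 0 := by
  let const (w : E) : Π y : E, TangentSpace 𝓘(ℝ, E) y := fun _ ↦ w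
  have hconst (w y : E) : MDiffAt (T% (const w)) y :=
    (contMDiffAt_vectorSpace_iff_contDiffAt (n := 1).2 contDiffAt_const).mdifferentiableAt (by simp)
  have hbracket : mlieBracket 𝓘(ℝ, E) (const u) (const v) = 0 := by
    rw [← mlieBracketWithin_univ, mlieBracketWithin_eq_lieBracketWithin]
    ext1 y
    change fderivWithin ℝ (fun _ : E ↦ v) Set.univ y u - fderivWithin ℝ (fun _ : E ↦ u) _ y v = 0
    simp
  have hpullback := mpullback_mlieBracket (n := 2) (hconst u _) (hconst v _)
    (contMDiffAt_extChartAt' (I := I) (x := p) (by simpa using hx)) (by simp)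
  refine hpullback.symm.trans ?_
  rw [mpullback_apply, hbracket]
  exact map_zero _

end ChartField

section ClosedOneForm

variable {E : Type*} [NormedAddCommGroup E] [NormedSpace ℝ E]
  {H : Type*} [TopologicalSpace H] {I : ModelWithCorners ℝ E H}
  {M : Type*} [TopologicalSpace M] [ChartedSpace H M]

/-- The one-form `α` read in the chart at `p`. -/
def chartOneForm [FiniteDimensional ℝ E] (α : Π x : M, TangentSpace I x →ₗ[ℝ] ℝ) (p : M) (z : E) :
    E →L[ℝ] ℝ :=
  LinearMap.toContinuousLinearMap (𝕜 := ℝ) (E := E) <| α ((extChartAt I p).symm z) ∘ₗ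
    (mfderiv% (extChartAt I p) ((extChartAt I p).symm z)).inverse.toLinearMap

theorem chartOneForm_apply [FiniteDimensional ℝ E] (α : Π x : M, TangentSpace I x →ₗ[ℝ] ℝ)
    (p : M) (z u : E) :
    chartOneForm α p z u = ((fun y ↦ α y (chartField I p u y)) ∘ (extChartAt I p).symm) z := rfl

variable [IsManifold I ∞ M]

/-- The one-form `α` is smooth and closed on `U`, i.e. `X (α Y) - Y (α X) = α [X, Y]` on `U`. It is
only evaluated on globally defined smooth vector fields. -/
structure IsClosedOneFormOn (α : Π x : M, TangentSpace I x →ₗ[ℝ] ℝ) (U : Set M) : Prop where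
  contMDiffAt : ∀ X : Π x : M, TangentSpace I x, CMDiff ∞ (T% X) → ∀ x ∈ U,
    CMDiffAt ∞ (fun y ↦ α y (X y)) x
  closed : ∀ X Y : Π x : M, TangentSpace I x, CMDiff ∞ (T% X) → CMDiff ∞ (T% Y) → ∀ x ∈ U,
    mvfderiv I (fun y ↦ α y (Y y)) x (X x) - mvfderiv I (fun y ↦ α y (X y)) x (Y x)
      = α x (mlieBracket I X Y x)

namespace IsClosedOneFormOn

variable {α β : Π x : M, TangentSpace I x →ₗ[ℝ] ℝ} {U : Set M} {x p : M}

theorem smul_add_smul (hα : IsClosedOneFormOn α U) (hβ : IsClosedOneFormOn β U) (a b : ℝ) :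
    IsClosedOneFormOn (a • α + b • β) U where
  contMDiffAt X hX x hx :=
    (contMDiffAt_const.mul (hα.contMDiffAt X hX x hx)).add
      (contMDiffAt_const.mul (hβ.contMDiffAt X hX x hx))
  closed X Y hX hY x hx := by
    have hderiv (Z : Π x : M, TangentSpace I x) (hZ : CMDiff ∞ (T% Z)) (v : TangentSpace I x) :
        mvfderiv I (fun y ↦ (a • α + b • β) y (Z y)) x v
          = a * mvfderiv I (fun y ↦ α y (Z y)) x v + b * mvfderiv I (fun y ↦ β y (Z y)) x v := by
      have hαZ := (hα.contMDiffAt Z hZ x hx).mdifferentiableAt (by simp)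
      have hβZ := (hβ.contMDiffAt Z hZ x hx).mdifferentiableAt (by simp)
      change mvfderiv I ((fun _ ↦ a) * (fun y ↦ α y (Z y)) + (fun _ ↦ b) * fun y ↦ β y (Z y)) x v
        = _
      rw [mvfderiv_add (mdifferentiableAt_const.mul hαZ) (mdifferentiableAt_const.mul hβZ),
        mvfderiv_mul mdifferentiableAt_const hαZ, mvfderiv_mul mdifferentiableAt_const hβZ]
      simp [mvfderiv_const]
    rw [hderiv Y hY, hderiv X hX]
    simp only [Pi.add_apply, Pi.smul_apply, LinearMap.add_apply, LinearMap.smul_apply, smul_eq_mul,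
      ← hα.closed X Y hX hY x hx, ← hβ.closed X Y hX hY x hx]
    ring

variable [FiniteDimensional ℝ E] [T2Space M]

theorem contMDiffAt_of_eventually (hα : IsClosedOneFormOn α U) (hx : x ∈ U)
    {X : Π x : M, TangentSpace I x} (hX : ∀ᶠ y in 𝓝 x, CMDiffAt ∞ (T% X) y) :
    CMDiffAt ∞ (fun y ↦ α y (X y)) x := by
  obtain ⟨X', hX', hXX'⟩ := exists_contMDiff_eventuallyEq_section hX
  refine (hα.contMDiffAt X' hX' x hx).congr_of_eventuallyEq ?_
  filter_upwards [hXX'] with y hy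
  rw [hy]

theorem closed_of_eventually (hα : IsClosedOneFormOn α U) (hx : x ∈ U)
    {X Y : Π x : M, TangentSpace I x} (hX : ∀ᶠ y in 𝓝 x, CMDiffAt ∞ (T% X) y)
    (hY : ∀ᶠ y in 𝓝 x, CMDiffAt ∞ (T% Y) y) :
    mvfderiv I (fun y ↦ α y (Y y)) x (X x) - mvfderiv I (fun y ↦ α y (X y)) x (Y x)
      = α x (mlieBracket I X Y x) := by
  obtain ⟨X', hX', hXX'⟩ := exists_contMDiff_eventuallyEq_section hX
  obtain ⟨Y', hY', hYY'⟩ := exists_contMDiff_eventuallyEq_section hY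
  have hαX : (fun y ↦ α y (X' y)) =ᶠ[𝓝 x] fun y ↦ α y (X y) :=
    hXX'.mono fun y hy ↦ congrArg (α y) hy
  have hαY : (fun y ↦ α y (Y' y)) =ᶠ[𝓝 x] fun y ↦ α y (Y y) :=
    hYY'.mono fun y hy ↦ congrArg (α y) hy
  rw [← mvfderiv_congr hαX, ← mvfderiv_congr hαY, ← hXX'.self_of_nhds, ← hYY'.self_of_nhds,
    hα.closed X' Y' hX' hY' x hx, Filter.EventuallyEq.mlieBracket_vectorField_eq hXX' hYY']

theorem contMDiffAt_apply_chartField (hα : IsClosedOneFormOn α U) (hxU : x ∈ U)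
    (hx : x ∈ (extChartAt I p).source) (u : E) :
    CMDiffAt ∞ (fun y ↦ α y (chartField I p u y)) x :=
  hα.contMDiffAt_of_eventually hxU <|
    Filter.mem_of_superset ((isOpen_extChartAt_source p).mem_nhds hx)
      fun _ hy ↦ contMDiffAt_chartField hy u

theorem mvfderiv_apply_chartField_comm (hα : IsClosedOneFormOn α U) (hxU : x ∈ U)
    (hx : x ∈ (extChartAt I p).source) (u v : E) :
    mvfderiv I (fun y ↦ α y (chartField I p v y)) x (chartField I p u x)
      = mvfderiv I (fun y ↦ α y (chartField I p u y)) x (chartField I p v x) := by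
  have hsmooth (w : E) : ∀ᶠ y in 𝓝 x, CMDiffAt ∞ (T% (chartField I p w)) y :=
    Filter.mem_of_superset ((isOpen_extChartAt_source p).mem_nhds hx)
      fun _ hy ↦ contMDiffAt_chartField hy w
  rw [← sub_eq_zero, hα.closed_of_eventually hxU (hsmooth u) (hsmooth v),
    mlieBracket_chartField hx, map_zero]

variable [I.Boundaryless]

theorem contDiffOn_chartOneForm (hα : IsClosedOneFormOn α U) (p : M) :
    ContDiffOn ℝ ∞ (chartOneForm α p)
      ((extChartAt I p).target ∩ (extChartAt I p).symm ⁻¹' U) := by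
  refine contDiffOn_clm_apply.2 fun u z hz ↦ ContDiffAt.contDiffWithinAt ?_
  have hx := (extChartAt I p).map_target hz.1
  have h := contDiffAt_comp_extChartAt_symm hx (hα.contMDiffAt_apply_chartField hz.2 hx u)
  rwa [(extChartAt I p).right_inv hz.1] at h

theorem fderiv_chartOneForm_comm (hα : IsClosedOneFormOn α U) {z : E}
    (hz : z ∈ (extChartAt I p).target) (hzU : (extChartAt I p).symm z ∈ U)
    (hdiff : DifferentiableAt ℝ (chartOneForm α p) z) (u v : E) :
    fderiv ℝ (chartOneForm α p) z u v = fderiv ℝ (chartOneForm α p) z v u := by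
  have hx := (extChartAt I p).map_target hz
  have hderiv (u v : E) : fderiv ℝ (chartOneForm α p) z u v
      = mvfderiv I (fun y ↦ α y (chartField I p v y)) ((extChartAt I p).symm z)
          (chartField I p u ((extChartAt I p).symm z)) := by
    rw [mvfderiv_chartField hx
      ((hα.contMDiffAt_apply_chartField hzU hx v).of_le (by exact_mod_cast le_top)),
      (extChartAt I p).right_inv hz,
      ← funext fun z ↦ chartOneForm_apply α p z v, fderiv_clm_apply hdiff (by fun_prop)]
    simp
  rw [hderiv, hderiv, hα.mvfderiv_apply_chartField_comm hzU hx]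

theorem exists_mvfderiv_eq (hα : IsClosedOneFormOn α U) (hU : IsOpen U) (hp : p ∈ U) :
    ∃ V ⊆ U, IsOpen V ∧ p ∈ V ∧ ∃ f : M → ℝ, CMDiff[V] ∞ f ∧
      ∀ x ∈ V, ∀ v : TangentSpace I x, mvfderiv I f x v = α x v := by
  let φ := extChartAt I p
  have hopen : IsOpen (φ.target ∩ φ.symm ⁻¹' U) :=
    (continuousOn_extChartAt_symm p).isOpen_inter_preimage (isOpen_extChartAt_target p) hU
  have hφp : φ p ∈ φ.target ∩ φ.symm ⁻¹' U :=
    ⟨mem_extChartAt_target p, by simpa [φ] using hp⟩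
  obtain ⟨r, hr, hball⟩ := Metric.isOpen_iff.1 hopen _ hφp
  have hη : ContDiffOn ℝ ∞ (chartOneForm α p) (Metric.ball (φ p) r) :=
    (hα.contDiffOn_chartOneForm p).mono hball
  have hηdiff := hη.differentiableOn (by simp)
  obtain ⟨F, hF⟩ := (convex_ball (φ p) r).exists_forall_hasFDerivAt_of_fderiv_symmetric
    Metric.isOpen_ball hηdiff fun z hz ↦ hα.fderiv_chartOneForm_comm (hball hz).1 (hball hz).2
      (hηdiff.differentiableAt (Metric.isOpen_ball.mem_nhds hz))
  have hFsmooth : ContDiffOn ℝ ∞ F (Metric.ball (φ p) r) :=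
    (contDiffOn_infty_iff_fderiv_of_isOpen Metric.isOpen_ball).2
      ⟨fun z hz ↦ (hF z hz).differentiableAt.differentiableWithinAt,
        hη.congr fun z hz ↦ (hF z hz).fderiv⟩
  refine ⟨φ.source ∩ φ ⁻¹' Metric.ball (φ p) r, fun x hx ↦ ?_,
    (continuousOn_extChartAt p).isOpen_inter_preimage (isOpen_extChartAt_source p)
      Metric.isOpen_ball, ⟨mem_extChartAt_source p, Metric.mem_ball_self hr⟩, F ∘ φ, ?_,
    fun x hx v ↦ ?_⟩
  · simpa [φ.left_inv hx.1] using (hball hx.2).2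
  · exact hFsmooth.contMDiffOn.comp
      (contMDiffOn_extChartAt.mono fun x hx ↦ by simpa [φ] using hx.1) fun x hx ↦ hx.2
  · have hchart : MDiffAt φ x := mdifferentiableAt_extChartAt (by simpa [φ] using hx.1)
    rw [mvfderiv_comp_of_hasFDerivAt (hF _ hx.2) hchart, chartOneForm_apply, Function.comp_apply,
      φ.left_inv hx.1, chartField_mvfderiv_extChartAt hx.1]

end IsClosedOneFormOn

end ClosedOneForm

variable {n : ℕ} {M : Type*} [TopologicalSpace M] [ChartedSpace (EuclideanSpace ℝ (Fin n)) M]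
  [IsManifold (𝓡 n) ∞ M] {D D' : AffineConnection n M} {g : Metric n M}

theorem mdifferentiableAt_smoothVectorField (X : SmoothVectorField n M) (x : M) :
    MDifferentiableAt (𝓡 n) (𝓡 n).tangent (T% (fun y ↦ X y)) x :=
  X.contMDiff.contMDiffAt.mdifferentiableAt (by simp)

/-- The Lie bracket `[X, Y]` as a smooth vector field. -/
def smoothLieBracket (X Y : SmoothVectorField n M) : SmoothVectorField n M :=
  ⟨mlieBracket (𝓡 n) X Y, fun _ ↦
    contMDiffAt_mlieBracket X.contMDiff.contMDiffAt Y.contMDiff.contMDiffAt⟩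

namespace AffineConnection

/-- The covariant derivative `∇_X Y` as a smooth vector field. -/
def covDeriv (D : AffineConnection n M) (hD : D.IsSmooth) (X Y : SmoothVectorField n M) :
    SmoothVectorField n M :=
  ⟨fun y ↦ D Y y (X y), fun _ ↦
    ((hD.contMDiff.contMDiff Y.contMDiff.contMDiffOn).contMDiffAt
      Filter.univ_mem).clm_bundle_apply X.contMDiff.contMDiffAt⟩

theorem apply_sub_apply_of_torsion_eq_zero (hT : D.torsion = 0)
    (X Y : SmoothVectorField n M) (x : M) :
    D Y x (X x) - D X x (Y x) = mlieBracket (𝓡 n) X Y x :=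
  D.torsion_eq_zero_iff.1 hT (mdifferentiableAt_smoothVectorField X x)
    (mdifferentiableAt_smoothVectorField Y x)

theorem covDeriv_eq_add_smoothLieBracket (hD : D.IsSmooth) (hT : D.torsion = 0)
    (X Y : SmoothVectorField n M) :
    D.covDeriv hD X Y = D.covDeriv hD Y X + smoothLieBracket X Y := by
  ext x
  exact sub_eq_iff_eq_add'.1 (apply_sub_apply_of_torsion_eq_zero hT X Y x)

end AffineConnection

open AffineConnection

theorem curvature_swap (D : AffineConnection n M) (X Y Z : Π x : M, TangentSpace (𝓡 n) x) (x : M) :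
    curvature D Y X Z x = -curvature D X Y Z x := by
  unfold curvature
  rw [mlieBracket_swap_apply, map_neg]
  module

theorem curvature_add_curvature_add_curvature (hD : D.IsSmooth) (hT : D.torsion = 0)
    (X Y Z : SmoothVectorField n M) (x : M) :
    curvature D X Y Z x + curvature D Y Z X x + curvature D Z X Y x = 0 := by
  have hcommute (X Y Z : SmoothVectorField n M) :
      D (fun y ↦ D Z y (Y y)) x (X x) - D (fun y ↦ D Y y (Z y)) x (X x)
        - D X x (mlieBracket (𝓡 n) Y Z x) = mlieBracket (𝓡 n) X (mlieBracket (𝓡 n) Y Z) x := by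
    have hadd : D (D.covDeriv hD Y Z) x = D (D.covDeriv hD Z Y) x + D (smoothLieBracket Y Z) x := by
      rw [covDeriv_eq_add_smoothLieBracket hD hT]
      exact D.isCovariantDerivativeOn.add
        (mdifferentiableAt_smoothVectorField (D.covDeriv hD Z Y) x)
        (mdifferentiableAt_smoothVectorField (smoothLieBracket Y Z) x)
    have htorsion := apply_sub_apply_of_torsion_eq_zero hT X (smoothLieBracket Y Z) x
    calc D (D.covDeriv hD Y Z) x (X x) - D (D.covDeriv hD Z Y) x (X x)
          - D X x (smoothLieBracket Y Z x)
        = D (smoothLieBracket Y Z) x (X x) - D X x (smoothLieBracket Y Z x) := by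
          rw [hadd, _root_.add_apply, add_sub_cancel_left]
      _ = mlieBracket (𝓡 n) X (mlieBracket (𝓡 n) Y Z) x := htorsion
  have hjacobi := mlieBracket_mlieBracket (I := 𝓡 n) (x := x) X.contMDiff.contMDiffAt
    Y.contMDiff.contMDiffAt Z.contMDiff.contMDiffAt
  rw [mlieBracket_swap_apply (V := mlieBracket (𝓡 n) X Y), neg_add_eq_sub] at hjacobi
  calc curvature D X Y Z x + curvature D Y Z X x + curvature D Z X Y x
      = mlieBracket (𝓡 n) X (mlieBracket (𝓡 n) Y Z) x
        - mlieBracket (𝓡 n) Y (mlieBracket (𝓡 n) X Z) x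
        + mlieBracket (𝓡 n) Z (mlieBracket (𝓡 n) X Y) x := by
        rw [← hcommute X Y Z, ← hcommute Y X Z, ← hcommute Z X Y]
        unfold curvature
        rw [mlieBracket_swap_apply (V := Z) (W := X), map_neg]
        abel
    _ = 0 := by rw [hjacobi]; abel

theorem contMDiff_inner (g : Metric n M) (X Y : SmoothVectorField n M) :
    ContMDiff (𝓡 n) 𝓘(ℝ, ℝ) ∞ (fun y ↦ g.inner y (X y) (Y y)) := fun x ↦ by
  have : ContMDiffAt (𝓡 n) ((𝓡 n).prod 𝓘(ℝ)) ∞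
      (T% (fun y ↦ (g.inner y (X y) (Y y) : Bundle.Trivial M ℝ y))) x :=
    ContMDiffAt.clm_bundle_apply₂ (F₁ := EuclideanSpace ℝ (Fin n))
      (F₂ := EuclideanSpace ℝ (Fin n)) g.contMDiff.contMDiffAt X.contMDiff.contMDiffAt
      Y.contMDiff.contMDiffAt
  exact (contMDiffAt_totalSpace.1 this).2

theorem IsDual.inner_curvature_add_inner_curvature (hdual : IsDual g D D') (hD : D.IsSmooth)
    (hD' : D'.IsSmooth) (X Y U V : SmoothVectorField n M) (x : M) :
    g.inner x (curvature D X Y U x) (V x) + g.inner x (U x) (curvature D' X Y V x) = 0 := by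
  have hsecond (X Y : SmoothVectorField n M) :
      mvfderiv (𝓡 n) (fun y ↦ mvfderiv (𝓡 n) (fun z ↦ g.inner z (U z) (V z)) y (Y y)) x (X x)
        = g.inner x (D (fun y ↦ D U y (Y y)) x (X x)) (V x)
          + g.inner x (D U x (Y x)) (D' V x (X x))
          + (g.inner x (D U x (X x)) (D' V x (Y x))
          + g.inner x (U x) (D' (fun y ↦ D' V y (Y y)) x (X x))) := by
    have hdiff (Z W : SmoothVectorField n M) :=
      (contMDiff_inner g Z W).mdifferentiable (by simp) x
    simp_rw [hdual Y U V]
    refine (DFunLike.congr_fun (mvfderiv_fun_add (hdiff (D.covDeriv hD Y U) V)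
      (hdiff U (D'.covDeriv hD' Y V))) (X x)).trans ?_
    exact congrArg₂ (· + ·) (hdual X (D.covDeriv hD Y U) V x) (hdual X U (D'.covDeriv hD' Y V) x)
  have hbracket := mvfderiv_mlieBracket X.contMDiff Y.contMDiff (contMDiff_inner g U V) x
  rw [hsecond X Y, hsecond Y X] at hbracket
  have hfirst := hdual (smoothLieBracket X Y) U V x
  change mvfderiv _ _ x (mlieBracket (𝓡 n) X Y x) = g.inner x (D U x (mlieBracket (𝓡 n) X Y x)) _ +
    g.inner x _ (D' V x (mlieBracket (𝓡 n) X Y x)) at hfirst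
  unfold curvature
  simp only [map_sub, _root_.sub_apply]
  linarith

/-- The smooth vector fields `E i` form a basis of each tangent space of `M` at a point of `U`. -/
abbrev IsSmoothFrameOn {ι : Type*} (E : ι → SmoothVectorField n M) (U : Set M) : Prop :=
  IsLocalFrameOn (𝓡 n) (EuclideanSpace ℝ (Fin n)) ∞ (fun i ↦ ⇑(E i)) U

namespace IsSmoothFrameOn

variable {ι : Type*} [Fintype ι] {E : ι → SmoothVectorField n M} {U : Set M} {x : M}

/-- The trace `v ↦ ∑ l, E^l (∇_v E_l)` of the connection form of `D` in the frame `E`. -/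
def connectionTrace (hE : IsSmoothFrameOn E U) (D : AffineConnection n M) (x : M) :
    TangentSpace (𝓡 n) x →ₗ[ℝ] ℝ :=
  ∑ l, hE.coeff l x ∘ₗ (D (E l) x : TangentSpace (𝓡 n) x →ₗ[ℝ] TangentSpace (𝓡 n) x)

/-- The trace of the curvature endomorphism `Z ↦ R(X, Y)Z`, computed in the frame `E`. -/
def curvatureTrace (hE : IsSmoothFrameOn E U) (D : AffineConnection n M)
    (X Y : SmoothVectorField n M) (x : M) : ℝ :=
  ∑ l, hE.coeff l x (curvature D X Y (E l) x)

theorem connectionTrace_apply (hE : IsSmoothFrameOn E U) (D : AffineConnection n M)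
    (v : TangentSpace (𝓡 n) x) :
    hE.connectionTrace D x v = ∑ l, hE.coeff l x (D (E l) x v) := by
  simp [connectionTrace]

theorem trace_eq_sum_coeff (hE : IsSmoothFrameOn E U) (hx : x ∈ U)
    (L : TangentSpace (𝓡 n) x →ₗ[ℝ] TangentSpace (𝓡 n) x) :
    LinearMap.trace ℝ (TangentSpace (𝓡 n) x) L = ∑ l, hE.coeff l x (L (E l x)) := by
  classical
  rw [LinearMap.trace_eq_matrix_trace ℝ (hE.toBasisAt hx)]
  simp [Matrix.trace, LinearMap.toMatrix_apply, IsLocalFrameOn.coeff, hx]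

theorem ricci_eq_sum_coeff (hE : IsSmoothFrameOn E U) (hD : D.IsSmooth) (hx : x ∈ U)
    (Y Z : SmoothVectorField n M) :
    ricci D hD Y Z x = ∑ l, hE.coeff l x (curvature D (E l) Y Z x) := by
  refine (hE.trace_eq_sum_coeff hx _).trans (Finset.sum_congr rfl fun l _ ↦ ?_)
  exact congrArg (hE.coeff l x) (TensorialAt.mkHom_apply (tensorialAt_curvature D hD Y Z x)
    (mdifferentiableAt_smoothVectorField (E l) x))

theorem ricci_sub_ricci_swap (hE : IsSmoothFrameOn E U) (hD : D.IsSmooth) (hT : D.torsion = 0)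
    (hx : x ∈ U) (Y Z : SmoothVectorField n M) :
    ricci D hD Y Z x - ricci D hD Z Y x = -hE.curvatureTrace D Y Z x := by
  rw [hE.ricci_eq_sum_coeff hD hx, hE.ricci_eq_sum_coeff hD hx, ← Finset.sum_sub_distrib,
    curvatureTrace, ← Finset.sum_neg_distrib]
  refine Finset.sum_congr rfl fun l _ ↦ ?_
  have hbianchi := curvature_add_curvature_add_curvature hD hT (E l) Y Z x
  rw [curvature_swap D (E l) Z Y] at hbianchi
  rw [← map_sub, ← map_neg]
  congr 1
  rw [← sub_eq_zero, ← hbianchi]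
  abel

theorem sum_coeff_covDeriv_covDeriv (hE : IsSmoothFrameOn E U) (hD : D.IsSmooth) (hU : U ∈ 𝓝 x)
    (X Y : SmoothVectorField n M) :
    ∑ l, hE.coeff l x (D (fun y ↦ D (E l) y (Y y)) x (X x)) =
      mvfderiv (𝓡 n) (fun y ↦ hE.connectionTrace D y (Y y)) x (X x)
        + ∑ l, ∑ m, hE.coeff m x (D (E l) x (Y x)) * hE.coeff l x (D (E m) x (X x)) := by
  have hsmooth (l : ι) := (D.covDeriv hD Y (E l)).contMDiff.contMDiffAt (x := x)
  simp_rw [connectionTrace_apply]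
  have hderiv := DFunLike.congr_fun (mvfderiv_sum Finset.univ fun l _ ↦
    (contMDiffAt_localFrame_coeff hE hU (hsmooth l) l).mdifferentiableAt (by simp)) (X x)
  refine Eq.trans ?_ (congrArg (· + _) hderiv.symm)
  rw [_root_.sum_apply, ← Finset.sum_add_distrib]
  exact Finset.sum_congr rfl fun l _ ↦
    localFrame_coeff_covariantDerivative D hE (by simp) hU (hsmooth l) (X x) l

theorem curvatureTrace_eq (hE : IsSmoothFrameOn E U) (hD : D.IsSmooth) (hU : U ∈ 𝓝 x)
    (X Y : SmoothVectorField n M) :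
    hE.curvatureTrace D X Y x =
      mvfderiv (𝓡 n) (fun y ↦ hE.connectionTrace D y (Y y)) x (X x)
        - mvfderiv (𝓡 n) (fun y ↦ hE.connectionTrace D y (X y)) x (Y x)
        - hE.connectionTrace D x (mlieBracket (𝓡 n) X Y x) := by
  have hcomm : ∑ l, ∑ m, hE.coeff m x (D (E l) x (X x)) * hE.coeff l x (D (E m) x (Y x))
      = ∑ l, ∑ m, hE.coeff m x (D (E l) x (Y x)) * hE.coeff l x (D (E m) x (X x)) := by
    rw [Finset.sum_comm]
    exact Finset.sum_congr rfl fun _ _ ↦ Finset.sum_congr rfl fun _ _ ↦ mul_comm _ _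
  simp only [curvatureTrace, curvature, map_sub, Finset.sum_sub_distrib]
  rw [hE.sum_coeff_covDeriv_covDeriv hD hU, hE.sum_coeff_covDeriv_covDeriv hD hU,
    ← connectionTrace_apply, hcomm]
  ring

theorem isUnit_det_inner [DecidableEq ι] (hE : IsSmoothFrameOn E U) (g : Metric n M) (hx : x ∈ U) :
    IsUnit (Matrix.of fun i j ↦ g.inner x (E i x) (E j x)).det := by
  let B : LinearMap.BilinForm ℝ (TangentSpace (𝓡 n) x) :=
    LinearMap.mk₂ ℝ (fun v w ↦ g.inner x v w) (by simp) (by simp) (by simp) (by simp)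
  have hB : B.Nondegenerate := by
    constructor <;> intro v hv <;> by_contra hv0 <;> exact (g.pos x v hv0).ne' (hv v)
  have hgram : (Matrix.of fun i j ↦ g.inner x (E i x) (E j x)) =
      LinearMap.BilinForm.toMatrix (hE.toBasisAt hx) B := by
    ext i j
    simp [B, LinearMap.BilinForm.toMatrix_apply]
  rw [hgram]
  exact ((LinearMap.BilinForm.nondegenerate_iff_det_ne_zero (hE.toBasisAt hx)).1 hB).isUnit

theorem curvatureTrace_add_curvatureTrace (hE : IsSmoothFrameOn E U) (hD : D.IsSmooth)
    (hD' : D'.IsSmooth) (hdual : IsDual g D D') (hx : x ∈ U) (X Y : SmoothVectorField n M) :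
    hE.curvatureTrace D X Y x + hE.curvatureTrace D' X Y x = 0 := by
  classical
  let curvatureMatrix (D : AffineConnection n M) : Matrix ι ι ℝ :=
    .of fun i m ↦ hE.coeff m x (curvature D X Y (E i) x)
  refine trace_add_trace_eq_zero (A := curvatureMatrix D) (B := curvatureMatrix D')
    (hE.isUnit_det_inner g hx) ?_
  ext i j
  have hij := hdual.inner_curvature_add_inner_curvature hD hD' X Y (E i) (E j) x
  rw [hE.coeff_sum_eq (curvature D X Y (E i)) hx, hE.coeff_sum_eq (curvature D' X Y (E j)) hx]
    at hij
  simp only [map_sum, map_smul, _root_.sum_apply, _root_.smul_apply, smul_eq_mul] at hij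
  simp only [Matrix.add_apply, Matrix.mul_apply, Matrix.zero_apply, Matrix.transpose_apply,
    curvatureMatrix, Matrix.of_apply]
  simp only [mul_comm (g.inner x _ _)]
  exact hij

end IsSmoothFrameOn

theorem exists_smoothVectorField_eventuallyEq [T2Space M] {X : Π x : M, TangentSpace (𝓡 n) x}
    {x : M} (hX : ∀ᶠ y in 𝓝 x, ContMDiffAt (𝓡 n) (𝓡 n).tangent ∞ (T% X) y) :
    ∃ X' : SmoothVectorField n M, ∀ᶠ y in 𝓝 x, X' y = X y :=
  let ⟨X', hX', hXX'⟩ := exists_contMDiff_eventuallyEq_section hX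
  ⟨⟨X', hX'⟩, hXX'⟩

theorem exists_isSmoothFrameOn [T2Space M] (p : M) :
    ∃ U : Set M, IsOpen U ∧ p ∈ U ∧ ∃ E : Fin n → SmoothVectorField n M, IsSmoothFrameOn E U := by
  let e := trivializationAt (EuclideanSpace ℝ (Fin n)) (TangentSpace (𝓡 n) : M → Type _) p
  let b := (EuclideanSpace.basisFun (Fin n) ℝ).toBasis
  have hframe := e.isLocalFrameOn_localFrame_baseSet (𝓡 n) ∞ b
  have hp : p ∈ e.baseSet := FiberBundle.mem_baseSet_trivializationAt' p
  choose E hE using fun i ↦ exists_smoothVectorField_eventuallyEq (x := p) <|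
    Filter.mem_of_superset (e.open_baseSet.mem_nhds hp)
      fun y hy ↦ hframe.contMDiffAt e.open_baseSet hy i
  obtain ⟨U, hUE, hU, hpU⟩ := eventually_nhds_iff.1
    ((Filter.eventually_all.2 hE).and (e.open_baseSet.mem_nhds hp))
  refine ⟨U, hU, hpU, E, (hframe.mono fun y hy ↦ (hUE y hy).2).congr fun i y hy ↦ ?_⟩
  exact ((hUE y hy).1 i).symm

theorem IsSmoothFrameOn.isClosedOneFormOn_connectionTrace {ι : Type*} [Fintype ι]
    {E : ι → SmoothVectorField n M} {U : Set M} (hE : IsSmoothFrameOn E U) (hU : IsOpen U)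
    (hD : D.IsSmooth)
    (hcurv : ∀ (X Y : SmoothVectorField n M), ∀ x ∈ U, hE.curvatureTrace D X Y x = 0) :
    IsClosedOneFormOn (hE.connectionTrace D) U where
  contMDiffAt X hX x hx := by
    simp only [connectionTrace_apply]
    exact ContMDiffAt.sum fun l _ ↦ contMDiffAt_localFrame_coeff hE (hU.mem_nhds hx)
      (D.covDeriv hD ⟨X, hX⟩ (E l)).contMDiff.contMDiffAt l
  closed X Y hX hY x hx := by
    rw [← sub_eq_zero, ← hcurv ⟨X, hX⟩ ⟨Y, hY⟩ x hx]
    exact (hE.curvatureTrace_eq hD (hU.mem_nhds hx) ⟨X, hX⟩ ⟨Y, hY⟩).symm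

theorem IsVolumeFormOn.smul {θ : TopForm n M} {U : Set M} (hθ : IsVolumeFormOn θ U)
    {h : M → ℝ} (hh : ContMDiffOn (𝓡 n) 𝓘(ℝ, ℝ) ∞ h U) (hh0 : ∀ x ∈ U, h x ≠ 0) :
    IsVolumeFormOn (fun x ↦ h x • θ x) U where
  smooth Y hY := hh.mul (hθ.smooth Y hY)
  ne_zero x hx := smul_ne_zero (hh0 x hx) (hθ.ne_zero x hx)

theorem covDerivForm_smul (D : AffineConnection n M) {θ : TopForm n M} {h : M → ℝ} {x : M}
    {Y : Fin n → Π x : M, TangentSpace (𝓡 n) x}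
    (hh : MDifferentiableAt (𝓡 n) 𝓘(ℝ, ℝ) h x)
    (hθY : MDifferentiableAt (𝓡 n) 𝓘(ℝ, ℝ) (fun y ↦ θ y fun i ↦ Y i y) x)
    (v : TangentSpace (𝓡 n) x) :
    covDerivForm D (fun y ↦ h y • θ y) x v Y
      = h x * covDerivForm D θ x v Y + mvfderiv (𝓡 n) h x v * θ x fun i ↦ Y i x := by
  have hderiv := DFunLike.congr_fun (mvfderiv_mul hh hθY) v
  unfold covDerivForm
  refine (congrArg (· - _) hderiv).trans ?_
  simp [mul_sub, Finset.mul_sum]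
  ring

namespace IsSmoothFrameOn

variable {E : Fin n → SmoothVectorField n M} {U V : Set M} {x p : M}

theorem continuous_coeff {ι : Type*} {E : ι → SmoothVectorField n M} (hE : IsSmoothFrameOn E U)
    (x : M) (i : ι) : Continuous (hE.coeff i x) :=
  LinearMap.continuous_of_finiteDimensional
    (show EuclideanSpace ℝ (Fin n) →ₗ[ℝ] ℝ from hE.coeff i x)

/-- The top form `E¹ ∧ ⋯ ∧ Eⁿ` built from the coframe dual to the frame `E`. -/
def coframeVolume (hE : IsSmoothFrameOn E U) : TopForm n M := fun x ↦
  { Matrix.detRowAlternating.compLinearMap (LinearMap.pi fun j ↦ hE.coeff j x) with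
    cont := Continuous.matrix_det <| continuous_matrix fun i j ↦
      (continuous_coeff hE x j).comp (continuous_apply i) }

theorem coframeVolume_apply (hE : IsSmoothFrameOn E U) (v : Fin n → TangentSpace (𝓡 n) x) :
    hE.coframeVolume x v = (Matrix.of fun i j ↦ hE.coeff j x (v i)).det := rfl

theorem contMDiffAt_coframeVolume (hE : IsSmoothFrameOn E U) (hU : U ∈ 𝓝 x)
    {Y : Fin n → Π x : M, TangentSpace (𝓡 n) x}
    (hY : ∀ i, ContMDiffAt (𝓡 n) (𝓡 n).tangent ∞ (T% (Y i)) x) :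
    ContMDiffAt (𝓡 n) 𝓘(ℝ, ℝ) ∞ (fun y ↦ hE.coframeVolume y fun i ↦ Y i y) x := by
  simp only [coframeVolume_apply, Matrix.det_apply']
  exact contMDiffAt_finsetSum fun σ _ ↦ contMDiffAt_const.mul <|
    contMDiffAt_finsetProd fun i _ ↦ contMDiffAt_localFrame_coeff hE hU (hY _) i

theorem isVolumeFormOn_coframeVolume (hE : IsSmoothFrameOn E U) (hV : IsOpen V) (hVU : V ⊆ U) :
    IsVolumeFormOn hE.coframeVolume V where
  smooth Y hY x hx :=
    (hE.contMDiffAt_coframeVolume (Filter.mem_of_superset (hV.mem_nhds hx) hVU) fun i ↦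
      (hY i).contMDiffAt (hV.mem_nhds hx)).contMDiffWithinAt
  ne_zero x hx h0 := by
    have h1 : hE.coframeVolume x (fun i ↦ E i x) = 1 := by
      rw [coframeVolume_apply, ← Matrix.det_one (n := Fin n) (R := ℝ)]
      congr 1
      ext i j
      rw [Matrix.of_apply, localFrame_coeff_self hE (hVU hx), Matrix.one_apply, Pi.single_apply]
      exact if_congr eq_comm rfl rfl
    simp [h0] at h1

theorem covDerivForm_coframeVolume (hE : IsSmoothFrameOn E U) (D : AffineConnection n M)
    (hU : U ∈ 𝓝 x) {Y : Fin n → Π x : M, TangentSpace (𝓡 n) x}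
    (hY : ∀ i, ContMDiffAt (𝓡 n) (𝓡 n).tangent ∞ (T% (Y i)) x) (v : TangentSpace (𝓡 n) x) :
    covDerivForm D hE.coframeVolume x v Y
      = -(hE.connectionTrace D x v * hE.coframeVolume x fun i ↦ Y i x) := by
  let C (y : M) : Matrix (Fin n) (Fin n) ℝ := .of fun i j ↦ hE.coeff j y (Y i y)
  let Ω : Matrix (Fin n) (Fin n) ℝ := .of fun m l ↦ hE.coeff l x (D (E m) x v)
  let dC : Matrix (Fin n) (Fin n) ℝ := .of fun i j ↦ mvfderiv (𝓡 n) (fun y ↦ C y i j) x v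
  have hderiv : mvfderiv (𝓡 n) (fun y ↦ hE.coframeVolume y fun i ↦ Y i y) x v
      = ∑ i, ((C x).updateRow i (dC.row i)).det :=
    mvfderiv_det (fun i j ↦
      (contMDiffAt_localFrame_coeff hE hU (hY i) j).mdifferentiableAt (by simp)) v
  have hrow (i : Fin n) :
      hE.coframeVolume x (Function.update (fun j ↦ Y j x) i (D (Y i) x v))
        = ((C x).updateRow i (dC.row i)).det + ((C x).updateRow i ((C x * Ω).row i)).det := by
    rw [← Matrix.det_updateRow_add, coframeVolume_apply]
    congr 1
    ext a l
    rcases eq_or_ne a i with rfl | ha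
    · simp [localFrame_coeff_covariantDerivative D hE (by simp) hU (hY a) v l, C, Ω, dC,
        Matrix.mul_apply]
    · simp [ha, C]
  unfold covDerivForm
  rw [hderiv]
  simp only [hrow, Finset.sum_add_distrib, sum_det_updateRow_mul, connectionTrace_apply]
  simp [coframeVolume_apply, Matrix.trace, C, Ω]

theorem exists_isParallelOn (hE : IsSmoothFrameOn E U) [T2Space M]
    (hclosed : IsClosedOneFormOn (hE.connectionTrace D) U) (hU : IsOpen U) (hp : p ∈ U) :
    ∃ V : Set M, IsOpen V ∧ p ∈ V ∧
      ∃ θ : TopForm n M, IsVolumeFormOn θ V ∧ IsParallelOn D θ V := by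
  obtain ⟨V, hVU, hV, hpV, f, hf, hfτ⟩ := hclosed.exists_mvfderiv_eq hU hp
  have hexp : ContMDiffOn (𝓡 n) 𝓘(ℝ, ℝ) ∞ (fun x ↦ Real.exp (f x)) V :=
    Real.contDiff_exp.contMDiff.comp_contMDiffOn hf
  refine ⟨V, hV, hpV, fun x ↦ Real.exp (f x) • hE.coframeVolume x,
    (hE.isVolumeFormOn_coframeVolume hV hVU).smul hexp fun x _ ↦ Real.exp_ne_zero _,
    fun Y hY x hx v ↦ ?_⟩
  have hVx := hV.mem_nhds hx
  have hUx := Filter.mem_of_superset hVx hVU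
  have hYx (i : Fin n) := (hY i).contMDiffAt hVx
  rw [covDerivForm_smul D ((hexp.contMDiffAt hVx).mdifferentiableAt (by simp))
      ((hE.contMDiffAt_coframeVolume hUx hYx).mdifferentiableAt (by simp)),
    hE.covDerivForm_coframeVolume D hUx hYx]
  have hderiv : mvfderiv (𝓡 n) (fun x ↦ Real.exp (f x)) x v
      = Real.exp (f x) * hE.connectionTrace D x v := by
    rw [← hfτ x hx v]
    refine (mvfderiv_comp_of_hasFDerivAt (Real.hasDerivAt_exp (f x)).hasFDerivAt
      ((hf.contMDiffAt hVx).mdifferentiableAt (by simp)) v).trans ?_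
    simp [mul_comm]
  rw [hderiv]
  ring

end IsSmoothFrameOn

theorem inner_right_injective (g : Metric n M) {x : M} {v w : TangentSpace (𝓡 n) x}
    (h : ∀ u, g.inner x u v = g.inner x u w) : v = w := by
  by_contra hne
  exact (g.pos x (v - w) (sub_ne_zero.2 hne)).ne' (by rw [map_sub, h, sub_self])

theorem exists_smoothVectorField_eq [T2Space M] {x : M} (v : TangentSpace (𝓡 n) x) :
    ∃ X : SmoothVectorField n M, X x = v := by
  obtain ⟨X, hX⟩ := exists_smoothVectorField_eventuallyEq <|
    Filter.mem_of_superset ((isOpen_extChartAt_source x).mem_nhds (mem_extChartAt_source x))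
      fun y hy ↦ contMDiffAt_chartField hy (mvfderiv (𝓡 n) (extChartAt (𝓡 n) x) x v)
  exact ⟨X, hX.self_of_nhds.trans (chartField_mvfderiv_extChartAt (mem_extChartAt_source x) v)⟩

theorem torsion_eq_zero_of_smoothVectorField [T2Space M]
    (h : ∀ (X Y : SmoothVectorField n M) (x : M),
      D Y x (X x) - D X x (Y x) = mlieBracket (𝓡 n) X Y x) : D.torsion = 0 := by
  ext1 x
  ext u v
  obtain ⟨X, rfl⟩ := exists_smoothVectorField_eq u
  obtain ⟨Y, rfl⟩ := exists_smoothVectorField_eq v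
  rw [D.torsion_apply (mdifferentiableAt_smoothVectorField X x)
    (mdifferentiableAt_smoothVectorField Y x), h, sub_self]
  rfl

theorem IsDual.cubicForm_eq (hdual : IsDual g D D') (X Y Z : SmoothVectorField n M) (x : M) :
    cubicForm g D X Y Z x = g.inner x (Y x) (D' Z x (X x) - D Z x (X x)) := by
  rw [cubicForm, hdual, map_sub]
  ring

theorem IsStatistical.torsion_dual_eq_zero [T2Space M] (hstat : IsStatistical g D)
    (hdual : IsDual g D D') : D'.torsion = 0 := by
  refine torsion_eq_zero_of_smoothVectorField fun X Z x ↦ ?_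
  have hdiff : D' Z x (X x) - D Z x (X x) = D' X x (Z x) - D X x (Z x) := by
    refine inner_right_injective g fun u ↦ ?_
    obtain ⟨Y, rfl⟩ := exists_smoothVectorField_eq u
    rw [← hdual.cubicForm_eq, ← hdual.cubicForm_eq, hstat.cubic_symm_right X Y Z,
      hstat.cubic_symm_left X Z Y, hstat.cubic_symm_right Z X Y]
  rw [← AffineConnection.apply_sub_apply_of_torsion_eq_zero hstat.torsion_free]
  exact sub_eq_zero.1 (by rw [sub_sub_sub_comm, hdiff, sub_self])

theorem ConjugateRicciSymmetric.ricci_symm [T2Space M] {hD : D.IsSmooth} {hD' : D'.IsSmooth}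
    (hricci : ConjugateRicciSymmetric D D' hD hD') (hT : D.torsion = 0) (hT' : D'.torsion = 0)
    (hdual : IsDual g D D') (Y Z : SmoothVectorField n M) (x : M) :
    ricci D hD Y Z x = ricci D hD Z Y x := by
  obtain ⟨U, -, hx, E, hE⟩ := exists_isSmoothFrameOn (n := n) x
  have h := hE.ricci_sub_ricci_swap hD hT hx Y Z
  have h' := hE.ricci_sub_ricci_swap hD' hT' hx Y Z
  have hsum := hE.curvatureTrace_add_curvatureTrace hD hD' hdual hx Y Z
  rw [← hricci Y Z x, ← hricci Z Y x] at h'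
  linarith

theorem isSmooth_alphaConnection (hD : D.IsSmooth) (hD' : D'.IsSmooth) (α : ℝ) :
    (alphaConnection D D' α).IsSmooth where
  contMDiff := ⟨fun hσ ↦ ContMDiffOn.add_section
    (contMDiffOn_const.smul_section (hD.contMDiff.contMDiff hσ))
    (contMDiffOn_const.smul_section (hD'.contMDiff.contMDiff hσ))⟩

theorem torsion_alphaConnection (hT : D.torsion = 0) (hT' : D'.torsion = 0) (α : ℝ) :
    (alphaConnection D D' α).torsion = 0 := by
  refine (CovariantDerivative.torsion_eq_zero_iff _).2 fun {X Y x} hX hY ↦ ?_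
  have h := D.torsion_eq_zero_iff.1 hT hX hY
  have h' := D'.torsion_eq_zero_iff.1 hT' hX hY
  change (((1 + α) / 2) • D Y x (X x) + ((1 - α) / 2) • D' Y x (X x))
    - (((1 + α) / 2) • D X x (Y x) + ((1 - α) / 2) • D' X x (Y x)) = _
  rw [add_sub_add_comm, ← smul_sub, ← smul_sub, h, h', ← add_smul]
  convert one_smul ℝ _ using 2
  ring

theorem IsSmoothFrameOn.connectionTrace_alphaConnection {ι : Type*} [Fintype ι]
    {E : ι → SmoothVectorField n M} {U : Set M} (hE : IsSmoothFrameOn E U)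
    (D D' : AffineConnection n M) (α : ℝ) :
    hE.connectionTrace (alphaConnection D D' α)
      = ((1 + α) / 2) • hE.connectionTrace D + ((1 - α) / 2) • hE.connectionTrace D' := by
  ext x v
  have hcoeff (l : ι) : hE.coeff l x (alphaConnection D D' α (E l) x v)
      = (1 + α) / 2 * hE.coeff l x (D (E l) x v) + (1 - α) / 2 * hE.coeff l x (D' (E l) x v) := by
    change hE.coeff l x (((1 + α) / 2) • D (E l) x v + ((1 - α) / 2) • D' (E l) x v) = _
    rw [map_add, map_smul, map_smul, smul_eq_mul, smul_eq_mul]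
  simp [connectionTrace_apply, hcoeff, Finset.sum_add_distrib, Finset.mul_sum]

end StatMfd

end

theorem corollary3p1_general {n : ℕ} {M : Type*} [TopologicalSpace M] [T2Space M]
    [ChartedSpace (EuclideanSpace ℝ (Fin n)) M] [IsManifold (𝓡 n) ∞ M]
    (g : StatMfd.Metric n M) (D D' : StatMfd.AffineConnection n M)
    (hD : D.IsSmooth) (hD' : D'.IsSmooth)
    (hstat : StatMfd.IsStatistical g D) (hdual : StatMfd.IsDual g D D')
    (hricci : ∀ (Y Z : StatMfd.SmoothVectorField n M) (x : M),
      StatMfd.ricci D hD Y Z x = StatMfd.ricci D hD Z Y x) (α : ℝ) :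
    StatMfd.IsEquiaffine (StatMfd.alphaConnection D D' α) where
  smooth := StatMfd.isSmooth_alphaConnection hD hD' α
  torsion_free :=
    StatMfd.torsion_alphaConnection hstat.torsion_free (hstat.torsion_dual_eq_zero hdual) α
  exists_parallel p := by
    obtain ⟨U, hU, hp, E, hE⟩ := StatMfd.exists_isSmoothFrameOn (n := n) p
    have hcurv (X Y : StatMfd.SmoothVectorField n M) (x : M) (hx : x ∈ U) :
        hE.curvatureTrace D X Y x = 0 := by
      have h := hE.ricci_sub_ricci_swap hD hstat.torsion_free hx X Y
      rwa [hricci, sub_self, zero_eq_neg] at h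
    have hcurv' (X Y : StatMfd.SmoothVectorField n M) (x : M) (hx : x ∈ U) :
        hE.curvatureTrace D' X Y x = 0 := by
      have h := hE.curvatureTrace_add_curvatureTrace hD hD' hdual hx X Y
      rwa [hcurv X Y x hx, zero_add] at h
    refine hE.exists_isParallelOn ?_ hU hp
    rw [hE.connectionTrace_alphaConnection]
    exact (hE.isClosedOneFormOn_connectionTrace hU hD hcurv).smul_add_smul
      (hE.isClosedOneFormOn_connectionTrace hU hD' hcurv') _ _

theorem corollary3p1 {n : ℕ} {M : Type*} [TopologicalSpace M] [T2Space M]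
    [ChartedSpace (EuclideanSpace ℝ (Fin n)) M] [IsManifold (𝓡 n) ∞ M]
    (g : StatMfd.Metric n M) (D D' : StatMfd.AffineConnection n M)
    (hD : D.IsSmooth) (hD' : D'.IsSmooth)
    (hstat : StatMfd.IsStatistical g D) (hdual : StatMfd.IsDual g D D')
    (hricci : StatMfd.ConjugateRicciSymmetric D D' hD hD') (α : ℝ) :
    StatMfd.IsEquiaffine (StatMfd.alphaConnection D D' α) :=
  corollary3p1_general g D D' hD hD' hstat hdual (hricci.ricci_symm hstat.torsion_free
    (hstat.torsion_dual_eq_zero hdual) hdual) α
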